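/- **Branch-and-bound trees.** A (general) branch-and-bound tree $\mathcal T$ in $\mathbb R^m$ is a finite full binary tree in which every internal node carries a disjunction $\pi^\top x\le \pi_0\ \vee\ \pi^\top x\ge \pi_0+1$ with $\pi\in\mathbb Z^m$, $\pi_0\in\mathbb Z$; one child adds the first inequality to the branching constraints of the node, the other child adds the second one, and the root has no branching constraints. The size $|\mathcal T|$ is the number of all nodes. For a polytope $P\subseteq\mathbb R^m$, the atom of a node is the set of points of $P$ that satisfy all branching constraints of that node. For $c\in\mathbb R^m$, the tree $\mathcal T$ *solves* $\max_{x\in P\cap\mathbb Z^m}\langle c,x\rangle$ if for every leaf $v$ one of the following holds: (i) the atom of $v$ is empty; (ii) the linear program $\max\{\langle c,x\rangle : x\in\text{atom of }v\}$ has an integral optimal solution; (iii) the optimal value of this linear program is at most the optimal value of $\langle c,\cdot\rangle$ over the atom of some node of $\mathcal T$ at which an integral optimal solution exists. Define $$\mathrm{BBhardness}(P)=\max_{c\in\mathbb R^m}\ \min\{|\mathcal T| : \mathcal T\text{ solves }\max_{x\in P\cap\mathbb Z^m}\langle c,x\rangle\}.$$ **The relaxation.** For $n$ cities let $V$ be the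 set of cities, $E$ the set of the $n(n-1)/2$ edges of the complete graph on $V$, $\delta(W)$ the set of edges with exactly one endpoint in $W\subseteq V$, $\delta(v)=\delta(\{v\})$ and $x(F)=\sum_{e\in F}x_e$. Let $T_{\mathrm{TSP}_n}$ be the set of all $x\in\mathbb R^{E}$ with $$x(\delta(v))=2\ (v\in V),\qquad x(\delta(W))\ge 2\ (\emptyset\ne W\subsetneq V),\qquad 0\le x_e\le 1\ (e\in E).$$ **Corollary (BB hardness for TSP).** For every $n$, the maximum and the minima that define $\mathrm{BBhardness}(T_{\mathrm{TSP}_n})$ exist, and $$\mathrm{BBhardness}(T_{\mathrm{TSP}_n})\ \ge\ 2^{\frac n{16}-2}.$$ That is, there is a vector $c\in\mathbb R^{n(n-1)/2}$ such that $\max_{x\in T_{\mathrm{TSP}_n}\cap\{0,1\}^{n(n-1)/2}}\langle c,x\rangle$ is solved by some branch-and-bound tree, and every branch-and-bound tree that solves it has size at least $2^{\frac n{16}-2}$. -/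

import Mathlib

open scoped Matrix

noncomputable section

/-- A (general) branch-and-bound tree over variables indexed by `ι`: a full binary tree in which
every internal node carries a disjunction `π · x ≤ π₀ ∨ π · x ≥ π₀ + 1` with integral data.
The left child adds the first constraint, the right child adds the second one. -/
inductive BBTree (ι : Type*) where
  | leaf : BBTree ι
  | branch (π : ι → ℤ) (π₀ : ℤ) (left right : BBTree ι) : BBTree ι

namespace BBTree

variable {ι : Type*}

/-- The size of a tree: the number of all its nodes (internal nodes and leaves). -/
def size : BBTree ι → ℕ
  | leaf => 1
  | branch _ _ l r => 1 + l.size + r.size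

variable [Fintype ι]

/-- The half-space `{x | π · x ≤ π₀}`. -/
def lowerSide (π : ι → ℤ) (π₀ : ℤ) : Set (ι → ℝ) :=
  {x | (fun i => (π i : ℝ)) ⬝ᵥ x ≤ (π₀ : ℝ)}

/-- The half-space `{x | π · x ≥ π₀ + 1}`. -/
def upperSide (π : ι → ℤ) (π₀ : ℤ) : Set (ι → ℝ) :=
  {x | (π₀ : ℝ) + 1 ≤ (fun i => (π i : ℝ)) ⬝ᵥ x}

/-- The atoms of all nodes of a tree run on `P`: the sets of points of `P` that satisfy all
branching constraints on the path from the root to the node. -/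
def atoms : BBTree ι → Set (ι → ℝ) → Set (Set (ι → ℝ))
  | leaf, P => {P}
  | branch π π₀ l r, P =>
      {P} ∪ (l.atoms (P ∩ lowerSide π π₀) ∪ r.atoms (P ∩ upperSide π π₀))

/-- The atoms of the leaves of a tree run on `P`. -/
def leafAtoms : BBTree ι → Set (ι → ℝ) → Set (Set (ι → ℝ))
  | leaf, P => {P}
  | branch π π₀ l r, P =>
      l.leafAtoms (P ∩ lowerSide π π₀) ∪ r.leafAtoms (P ∩ upperSide π π₀)

/-- `z` is an integral optimal solution of the linear program `max {c · x | x ∈ A}`. -/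
def IsIntegralOptimum (c : ι → ℝ) (A : Set (ι → ℝ)) (z : ι → ℝ) : Prop :=
  z ∈ A ∧ (∀ i, ∃ k : ℤ, z i = (k : ℝ)) ∧ ∀ x ∈ A, c ⬝ᵥ x ≤ c ⬝ᵥ z

/-- The tree solves `max {c · x | x ∈ P ∩ ℤ^ι}`: the atom of every leaf is empty, or its linear
program has an integral optimal solution, or the value of its linear program is at most the
value of some atom of the tree that has an integral optimal solution. -/
def Solves (T : BBTree ι) (P : Set (ι → ℝ)) (c : ι → ℝ) : Prop :=
  ∀ A ∈ T.leafAtoms P,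
    A = ∅ ∨
    (∃ z, IsIntegralOptimum c A z) ∨
    (∃ B ∈ T.atoms P, ∃ z, IsIntegralOptimum c B z ∧ ∀ x ∈ A, c ⬝ᵥ x ≤ c ⬝ᵥ z)

end BBTree

/-- The sizes of the branch-and-bound trees that solve `max {c · x | x ∈ P ∩ ℤ^ι}`. -/
def solvingSizes {ι : Type*} [Fintype ι] (P : Set (ι → ℝ)) (c : ι → ℝ) : Set ℕ :=
  {s | ∃ T : BBTree ι, T.Solves P c ∧ T.size = s}

/-- The numbers that are, for some objective `c`, the minimum size of a solving tree. -/
def minSolvingSizes {ι : Type*} [Fintype ι] (P : Set (ι → ℝ)) : Set ℕ :=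
  {m | ∃ c : ι → ℝ, IsLeast (solvingSizes P c) m}

/-- The BB hardness of `P`: the maximum over all objectives of the minimum size of a
solving tree (meaningful when this maximum exists). -/
def BBhardness {ι : Type*} [Fintype ι] (P : Set (ι → ℝ)) : ℕ :=
  sSup (minSolvingSizes P)

/-- The edges of the complete graph on the cities `0, …, n - 1`. -/
abbrev TSPEdge (n : ℕ) : Type := (⊤ : SimpleGraph (Fin n)).edgeSet

/-- The set `δ(W)` of edges with exactly one endpoint in `W`. -/
def cutEdges {n : ℕ} (W : Set (Fin n)) : Set (TSPEdge n) :=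
  {e | ∃ u ∈ W, ∃ v ∉ W, (e : Sym2 (Fin n)) = s(u, v)}

open Classical in
/-- The value `x(F) = ∑ e ∈ F, x e`. -/
def edgeWeight {n : ℕ} (x : TSPEdge n → ℝ) (F : Set (TSPEdge n)) : ℝ :=
  ∑ e : TSPEdge n, if e ∈ F then x e else 0

/-- The linear programming relaxation of the traveling salesman polytope on `n` cities given by
the degree constraints, the subtour elimination constraints and the bounds `0 ≤ x ≤ 1`. -/
def tspRelaxation (n : ℕ) : Set (TSPEdge n → ℝ) :=
  {x | (∀ v : Fin n, edgeWeight x (cutEdges {v}) = 2) ∧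
    (∀ W : Set (Fin n), W.Nonempty → W ≠ Set.univ → 2 ≤ edgeWeight x (cutEdges W)) ∧
    ∀ e : TSPEdge n, 0 ≤ x e ∧ x e ≤ 1}

end

/-! Consider a family of integral points whose pairwise midpoints lie in the polytope and are
strictly better than all its integral points. A disjunction leaves every integral point on one of
its sides, and two points on the same side keep their midpoint there. No leaf of a solving tree can
contain such a midpoint, so at most one member of the family ends at each leaf
(`BBTree.Solves.card_le_size`).

The family consists of 2-factors given by successor permutations of the cities. A permutation of
sign (-1)^n is not an n-cycle, so its 2-factor violates a subtour constraint
(`exists_invariant_of_sign`). Three parallel strands run around the cities; one transposition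
adjusts the sign, and at regular places the strands may be rotated by a three-cycle. Three-cycles
are even, so every choice of rotations keeps the sign. The objective rewards edges common to all
choices and punishes edges used by none. The degree constraints force an integral point as good as
the family to be supported on the 2-factor of some choice, which is disconnected
(`SwitchSystem.lt_value`).

A midpoint satisfies the subtour constraint of W if the two permutations leave W at least twice in
total. If one of them never leaves W, then W splits every triple of strands, and the other one
leaves W at every triple where the choices differ. Differing at two triples therefore suffices
(`SwitchSystem.midpoint_mem`). Repeating each bit on two triples costs twelve cities and yields
2^⌊n/12⌋ points. -/

/-! ### Lower bounds for solving trees from midpoints of integral points -/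

namespace BBTree

variable {ι κ : Type*}

theorem one_le_size (T : BBTree ι) : 1 ≤ T.size := by
  cases T <;> simp [size]; omega

variable [Fintype ι]

theorem leafAtoms_subset (T : BBTree ι) {P A : Set (ι → ℝ)} (hA : A ∈ T.leafAtoms P) :
    A ⊆ P := by
  induction T generalizing P with
  | leaf => exact (Set.mem_singleton_iff.1 hA).subset
  | branch π π₀ l r hl hr =>
    rcases hA with h | h
    · exact (hl h).trans Set.inter_subset_left
    · exact (hr h).trans Set.inter_subset_left

theorem atoms_subset (T : BBTree ι) {P A : Set (ι → ℝ)} (hA : A ∈ T.atoms P) : A ⊆ P := by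
  induction T generalizing P with
  | leaf => exact (Set.mem_singleton_iff.1 hA).subset
  | branch π π₀ l r hl hr =>
    rcases hA with h | h | h
    · exact (Set.mem_singleton_iff.1 h).subset
    · exact (hl h).trans Set.inter_subset_left
    · exact (hr h).trans Set.inter_subset_left

theorem dotProduct_midpoint (p x y : ι → ℝ) :
    p ⬝ᵥ midpoint ℝ x y = (p ⬝ᵥ x + p ⬝ᵥ y) / 2 := by
  rw [midpoint_eq_smul_add, dotProduct_smul, dotProduct_add, smul_eq_mul, invOf_eq_inv]
  ring

/-- If every two points of a family of integral points have their midpoint in `P`, and no such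
midpoint lies in the atom of a leaf, then every point is in a leaf of its own. -/
theorem card_le_size (f : κ → ι → ℝ) (hf : ∀ k i, ∃ a : ℤ, f k i = a) (T : BBTree ι) :
    ∀ (P : Set (ι → ℝ)) (S : Finset κ),
      (∀ i ∈ S, ∀ j ∈ S, i ≠ j → midpoint ℝ (f i) (f j) ∈ P) →
      (∀ A ∈ T.leafAtoms P, ∀ i ∈ S, ∀ j ∈ S, i ≠ j → midpoint ℝ (f i) (f j) ∉ A) →
      S.card ≤ T.size := by
  classical
  induction T with
  | leaf =>
    intro P S hP hA
    refine Finset.card_le_one.2 fun i hi j hj => ?_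
    by_contra hij
    exact hA P rfl i hi j hj hij (hP i hi j hj hij)
  | branch π π₀ l r hl hr =>
    intro P S hP hA
    have hint (k : κ) : ∃ a : ℤ, (fun i => (π i : ℝ)) ⬝ᵥ f k = a := by
      choose a ha using hf k
      exact ⟨∑ i, π i * a i, by simp [dotProduct, ha]⟩
    have h₁ := hl (P ∩ lowerSide π π₀)
      (S.filter fun k => (fun i => (π i : ℝ)) ⬝ᵥ f k ≤ π₀) (by
        intro i hi j hj hij
        rw [Finset.mem_filter] at hi hj
        refine ⟨hP i hi.1 j hj.1 hij, ?_⟩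
        rw [lowerSide, Set.mem_ofPred_eq, dotProduct_midpoint]
        linarith [hi.2, hj.2])
      fun A h i hi j hj => hA A (Or.inl h) i (Finset.mem_filter.1 hi).1 j (Finset.mem_filter.1 hj).1
    have h₂ := hr (P ∩ upperSide π π₀)
      (S.filter fun k => ¬ (fun i => (π i : ℝ)) ⬝ᵥ f k ≤ π₀) (by
        -- Integrality enters here: no member of the family lies strictly between the two sides.
        have key (k : κ) (hk : ¬ (fun i => (π i : ℝ)) ⬝ᵥ f k ≤ π₀) :
            (π₀ : ℝ) + 1 ≤ (fun i => (π i : ℝ)) ⬝ᵥ f k := by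
          obtain ⟨a, ha⟩ := hint k
          rw [ha] at hk ⊢
          norm_cast at hk ⊢
          omega
        intro i hi j hj hij
        rw [Finset.mem_filter] at hi hj
        refine ⟨hP i hi.1 j hj.1 hij, ?_⟩
        rw [upperSide, Set.mem_ofPred_eq, dotProduct_midpoint]
        linarith [key i hi.2, key j hj.2])
      fun A h i hi j hj => hA A (Or.inr h) i (Finset.mem_filter.1 hi).1 j (Finset.mem_filter.1 hj).1
    rw [← Finset.card_filter_add_card_filter_not fun k => (fun i => (π i : ℝ)) ⬝ᵥ f k ≤ π₀, size]
    omega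

/-- If the midpoints of a family of integral points are in `P` and are strictly better than all
integral points of `P`, then every solving tree has at least as many nodes as the family has
members. -/
theorem Solves.card_le_size [Fintype κ] {T : BBTree ι} {P : Set (ι → ℝ)} {c : ι → ℝ}
    (hT : T.Solves P c) (f : κ → ι → ℝ) (hf : ∀ k i, ∃ a : ℤ, f k i = a)
    (hP : ∀ i j, i ≠ j → midpoint ℝ (f i) (f j) ∈ P)
    (hc : ∀ z ∈ P, (∀ i, ∃ a : ℤ, z i = a) → ∀ k, c ⬝ᵥ z < c ⬝ᵥ f k) :
    Fintype.card κ ≤ T.size := by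
  refine BBTree.card_le_size f hf T P Finset.univ (fun i _ j _ => hP i j) ?_
  intro A hA i _ j _ _ hm
  have key (z : ι → ℝ) (hz : z ∈ P) (hz' : ∀ i, ∃ a : ℤ, z i = a) :
      c ⬝ᵥ z < c ⬝ᵥ midpoint ℝ (f i) (f j) := by
    rw [dotProduct_midpoint]
    linarith [hc z hz hz' i, hc z hz hz' j]
  rcases hT A hA with rfl | ⟨z, hz⟩ | ⟨B, hB, z, hz, hle⟩
  · exact hm
  · exact (key z (T.leafAtoms_subset hA hz.1) hz.2.1).not_ge (hz.2.2 _ hm)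
  · exact (key z (T.atoms_subset hB hz.1) hz.2.1).not_ge (hle _ hm)

/-! ### Existence of solving trees for 0/1 polytopes -/

variable [DecidableEq ι]

/-- The tree that branches on `x i ≤ 0 ∨ x i ≥ 1` for all variables of a list. -/
def full : List ι → BBTree ι
  | [] => leaf
  | i :: l => branch (Pi.single i 1) 0 (full l) (full l)

theorem fixed_of_mem_leafAtoms_full (l : List ι) {P A : Set (ι → ℝ)}
    (hA : A ∈ (full l).leafAtoms P) {i : ι} (hi : i ∈ l) :
    (∀ x ∈ A, x i ≤ 0) ∨ ∀ x ∈ A, 1 ≤ x i := by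
  have single (j : ι) (x : ι → ℝ) :
      (fun i => (((Pi.single j 1 : ι → ℤ) i : ℤ) : ℝ)) ⬝ᵥ x = x j := by
    simp [dotProduct, Pi.single_apply]
  induction l generalizing P with
  | nil => simp at hi
  | cons j l ih =>
    by_cases hil : i ∈ l
    · exact hA.elim (fun h => ih h hil) fun h => ih h hil
    obtain rfl : i = j := (List.mem_cons.1 hi).resolve_right hil
    rcases hA with h | h
    · refine Or.inl fun x hx => ?_
      have := (leafAtoms_subset _ h hx).2
      rw [lowerSide, Set.mem_ofPred_eq, single] at this
      simpa using this
    · refine Or.inr fun x hx => ?_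
      have := (leafAtoms_subset _ h hx).2
      rw [upperSide, Set.mem_ofPred_eq, single] at this
      simpa using this

/-- Once every variable is fixed to 0 or 1, an atom has at most one point, and that point is
integral. -/
theorem solves_full {P : Set (ι → ℝ)} (hP : ∀ x ∈ P, ∀ i, 0 ≤ x i ∧ x i ≤ 1) (c : ι → ℝ) :
    (full (Finset.univ : Finset ι).toList).Solves P c := by
  intro A hA
  rcases A.eq_empty_or_nonempty with h | ⟨z, hz⟩
  · exact Or.inl h
  have sub := leafAtoms_subset _ hA
  have val (i : ι) : (∀ x ∈ A, x i = 0) ∨ ∀ x ∈ A, x i = 1 :=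
    (fixed_of_mem_leafAtoms_full _ hA (i := i) (by simp)).imp
      (fun h x hx => le_antisymm (h x hx) (hP x (sub hx) i).1)
      (fun h x hx => le_antisymm (hP x (sub hx) i).2 (h x hx))
  refine Or.inr (Or.inl ⟨z, hz, fun i => ?_, fun x hx => ?_⟩)
  · rcases val i with h | h
    · exact ⟨0, by simpa using h z hz⟩
    · exact ⟨1, by simpa using h z hz⟩
  · have : x = z := funext fun i => by
      rcases val i with h | h <;> rw [h x hx, h z hz]
    rw [this]

end BBTree

/-! ### Existence of the maximum and the minima -/

section Hardness

variable {ι : Type*} [Fintype ι] {P : Set (ι → ℝ)}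

theorem exists_isLeast_solvingSizes (hP : ∀ x ∈ P, ∀ i, 0 ≤ x i ∧ x i ≤ 1) (c : ι → ℝ) :
    ∃ m, IsLeast (solvingSizes P c) m := by
  classical
  have h : (solvingSizes P c).Nonempty := ⟨_, _, BBTree.solves_full hP c, rfl⟩
  exact ⟨_, Nat.sInf_mem h, fun _ hs => Nat.sInf_le hs⟩

/-- The full tree does not depend on the objective, so its size bounds all minima at once. -/
theorem bddAbove_minSolvingSizes (hP : ∀ x ∈ P, ∀ i, 0 ≤ x i ∧ x i ≤ 1) :
    BddAbove (minSolvingSizes P) := by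
  classical
  refine ⟨(BBTree.full (Finset.univ : Finset ι).toList).size, ?_⟩
  rintro m ⟨c, hm⟩
  exact hm.2 ⟨_, BBTree.solves_full hP c, rfl⟩

theorem isGreatest_BBhardness (hP : ∀ x ∈ P, ∀ i, 0 ≤ x i ∧ x i ≤ 1) :
    IsGreatest (minSolvingSizes P) (BBhardness P) := by
  obtain ⟨m, hm⟩ := exists_isLeast_solvingSizes hP 0
  exact ⟨Nat.sSup_mem ⟨m, 0, hm⟩ (bddAbove_minSolvingSizes hP),
    fun _ h => le_csSup (bddAbove_minSolvingSizes hP) h⟩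

theorem le_BBhardness (hP : ∀ x ∈ P, ∀ i, 0 ≤ x i ∧ x i ≤ 1) {c : ι → ℝ} {b : ℝ}
    (hc : ∀ T : BBTree ι, T.Solves P c → b ≤ T.size) : b ≤ BBhardness P := by
  obtain ⟨m, hm⟩ := exists_isLeast_solvingSizes hP c
  obtain ⟨T, hT, rfl⟩ := hm.1
  exact (hc T hT).trans (by exact_mod_cast (isGreatest_BBhardness hP).2 ⟨c, hm⟩)

end Hardness

/-! ### 2-factors of permutations and their cuts -/

section TwoFactor

open Equiv

variable {n : ℕ}

/-- The edge between two cities. -/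
def tspEdge (u v : Fin n) (h : u ≠ v) : TSPEdge n := ⟨s(u, v), h⟩

theorem tspEdge_mem_cutEdges {u v : Fin n} (h : u ≠ v) (W : Set (Fin n)) :
    tspEdge u v h ∈ cutEdges W ↔ ¬ (u ∈ W ↔ v ∈ W) := by
  constructor
  · rintro ⟨a, ha, b, hb, hab⟩
    rcases Sym2.eq_iff.1 hab with ⟨rfl, rfl⟩ | ⟨rfl, rfl⟩ <;> tauto
  · intro h'
    by_cases hu : u ∈ W
    · exact ⟨u, hu, v, by tauto, rfl⟩
    · exact ⟨v, by tauto, u, hu, Sym2.eq_swap⟩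

theorem mem_cutEdges_singleton {a : Fin n} {e : TSPEdge n} :
    e ∈ cutEdges {a} ↔ a ∈ (e : Sym2 (Fin n)) := by
  obtain ⟨⟨u, v⟩, h⟩ := e
  have h' : u ≠ v := h
  refine (tspEdge_mem_cutEdges h' {a}).trans ?_
  change _ ↔ a ∈ s(u, v)
  rw [Sym2.mem_iff, Set.mem_singleton_iff, Set.mem_singleton_iff]
  constructor
  · intro; by_contra; tauto
  · rintro (rfl | rfl) <;> tauto

theorem edgeWeight_add (x y : TSPEdge n → ℝ) (F : Set (TSPEdge n)) :
    edgeWeight (x + y) F = edgeWeight x F + edgeWeight y F := by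
  rw [edgeWeight, edgeWeight, edgeWeight, ← Finset.sum_add_distrib]
  refine Finset.sum_congr rfl fun e _ => ?_
  split_ifs <;> simp

theorem edgeWeight_midpoint (x y : TSPEdge n → ℝ) (F : Set (TSPEdge n)) :
    edgeWeight (midpoint ℝ x y) F = (edgeWeight x F + edgeWeight y F) / 2 := by
  rw [← edgeWeight_add, midpoint_eq_smul_add, edgeWeight, edgeWeight, Finset.sum_div]
  refine Finset.sum_congr rfl fun e _ => ?_
  split_ifs
  · simp; ring
  · simp

/-- The incidence vector of the edges `{v, π v}`. -/
noncomputable def twoFactor (π : Perm (Fin n)) (e : TSPEdge n) : ℝ :=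
  ∑ v, if (e : Sym2 (Fin n)) = s(v, π v) then 1 else 0

theorem twoFactor_nonneg (π : Perm (Fin n)) (e : TSPEdge n) : 0 ≤ twoFactor π e :=
  Finset.sum_nonneg fun v _ => by split_ifs <;> norm_num

theorem twoFactor_integral (π : Perm (Fin n)) (e : TSPEdge n) :
    ∃ a : ℤ, twoFactor π e = a :=
  ⟨∑ v, if (e : Sym2 (Fin n)) = s(v, π v) then 1 else 0, by simp [twoFactor]⟩

theorem one_le_twoFactor (π : Perm (Fin n)) (e : TSPEdge n) (v : Fin n)
    (h : (e : Sym2 (Fin n)) = s(v, π v)) : 1 ≤ twoFactor π e := by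
  have := Finset.single_le_sum (f := fun v => if (e : Sym2 (Fin n)) = s(v, π v) then (1 : ℝ) else 0)
    (fun v _ => by split_ifs <;> norm_num) (Finset.mem_univ v)
  simpa [h, twoFactor] using this

theorem twoFactor_eq_zero (π : Perm (Fin n)) (e : TSPEdge n)
    (h : ∀ v, (e : Sym2 (Fin n)) ≠ s(v, π v)) : twoFactor π e = 0 :=
  Finset.sum_eq_zero fun v _ => if_neg (h v)

/-- Two different cities can yield the same edge only if `π` interchanges them. -/
theorem twoFactor_le_one (π : Perm (Fin n)) (h₂ : ∀ v, π (π v) ≠ v) (e : TSPEdge n) :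
    twoFactor π e ≤ 1 := by
  rw [twoFactor, Finset.sum_boole]
  norm_cast
  refine Finset.card_le_one.2 fun a ha b hb => ?_
  rw [Finset.mem_filter] at ha hb
  rcases Sym2.eq_iff.1 (ha.2.symm.trans hb.2) with h | ⟨h, h'⟩
  · exact h.1
  · exact absurd (by rw [h', h]) (h₂ a)

open Classical in
/-- The number of points of `W` that a permutation moves out of `W`. -/
noncomputable def outCount (π : Perm (Fin n)) (W : Set (Fin n)) : ℕ :=
  (Finset.univ.filter fun v => v ∈ W ∧ π v ∉ W).card

-- `W` and its preimage under `π` have equal size; removing their common part leaves equally many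
-- points.
open Classical in
theorem card_moved_in (π : Perm (Fin n)) (W : Set (Fin n)) :
    (Finset.univ.filter fun v => v ∉ W ∧ π v ∈ W).card = outCount π W := by
  have h₁ := Finset.card_filter_add_card_filter_not (s := Finset.univ.filter fun v => v ∈ W)
    fun v => π v ∈ W
  have h₂ := Finset.card_filter_add_card_filter_not (s := Finset.univ.filter fun v => π v ∈ W)
    fun v => v ∈ W
  have h₃ : (Finset.univ.filter fun v => π v ∈ W).card =
      (Finset.univ.filter fun v => v ∈ W).card :=
    Finset.card_bijective π π.bijective (by simp)
  simp only [Finset.filter_filter] at h₁ h₂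
  simp only [and_comm (a := π _ ∈ W)] at h₂
  rw [outCount]
  omega

/-- An arc from `v` to `π v` counts when it leaves or enters `W`, and a permutation enters `W` as
often as it leaves it. -/
theorem edgeWeight_twoFactor (π : Perm (Fin n)) (h₁ : ∀ v, π v ≠ v) (W : Set (Fin n)) :
    edgeWeight (twoFactor π) (cutEdges W) = 2 * outCount π W := by
  classical
  have key (v : Fin n) : (∑ e : TSPEdge n, if e ∈ cutEdges W then
      (if (e : Sym2 (Fin n)) = s(v, π v) then (1 : ℝ) else 0) else 0) =
      (if v ∈ W ∧ π v ∉ W then 1 else 0) + if v ∉ W ∧ π v ∈ W then 1 else 0 := by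
    rw [Finset.sum_eq_single (tspEdge v (π v) (h₁ v).symm)]
    · rw [if_pos (c := ((tspEdge v (π v) (h₁ v).symm : TSPEdge n) : Sym2 (Fin n)) = s(v, π v)) rfl]
      simp only [tspEdge_mem_cutEdges]
      by_cases h : v ∈ W <;> by_cases h' : π v ∈ W <;> simp [h, h']
    · intro e _ he
      rw [if_neg (c := (e : Sym2 (Fin n)) = s(v, π v)) fun h => he (Subtype.ext h), ite_self]
    · simp
  have : edgeWeight (twoFactor π) (cutEdges W) = ∑ v, ∑ e : TSPEdge n, if e ∈ cutEdges W then
      (if (e : Sym2 (Fin n)) = s(v, π v) then (1 : ℝ) else 0) else 0 := by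
    rw [Finset.sum_comm, edgeWeight]
    refine Finset.sum_congr rfl fun e _ => ?_
    split_ifs
    · rfl
    · simp
  rw [this, Finset.sum_congr rfl fun v _ => key v, Finset.sum_add_distrib, Finset.sum_boole,
    Finset.sum_boole, card_moved_in, outCount]
  ring

theorem outCount_singleton (π : Perm (Fin n)) (h₁ : ∀ v, π v ≠ v) (a : Fin n) :
    outCount π {a} = 1 := by
  rw [outCount, Finset.card_eq_one]
  refine ⟨a, Finset.ext fun v => ?_⟩
  simp only [Finset.mem_filter, Finset.mem_univ, true_and, Set.mem_singleton_iff,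
    Finset.mem_singleton, and_iff_left_iff_imp]
  rintro rfl
  exact h₁ v

theorem two_le_outCount {π : Perm (Fin n)} {W : Set (Fin n)} {u v : Fin n} (huv : u ≠ v)
    (hu : u ∈ W) (hu' : π u ∉ W) (hv : v ∈ W) (hv' : π v ∉ W) : 2 ≤ outCount π W :=
  Finset.one_lt_card.2 ⟨u, by simp [hu, hu'], v, by simp [hv, hv'], huv⟩

theorem invariant_of_outCount_eq_zero {π : Perm (Fin n)} {W : Set (Fin n)}
    (h : outCount π W = 0) (v : Fin n) : π v ∈ W ↔ v ∈ W := by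
  classical
  have h' := card_moved_in π W
  rw [h, Finset.card_eq_zero, Finset.filter_eq_empty_iff] at h'
  rw [outCount, Finset.card_eq_zero, Finset.filter_eq_empty_iff] at h
  have h₁ := h (Finset.mem_univ v)
  have h₂ := h' (Finset.mem_univ v)
  tauto

/-- The midpoint of two 2-factors satisfies the subtour constraints if every union of cycles of
one of them is crossed at least twice in each direction by the other one. -/
theorem midpoint_twoFactor_mem (π ρ : Perm (Fin n)) (hπ₁ : ∀ v, π v ≠ v) (hρ₁ : ∀ v, ρ v ≠ v)
    (hπ₂ : ∀ v, π (π v) ≠ v) (hρ₂ : ∀ v, ρ (ρ v) ≠ v)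
    (hπ : ∀ W : Set (Fin n), W.Nonempty → W ≠ Set.univ → (∀ v, π v ∈ W ↔ v ∈ W) →
      2 ≤ outCount ρ W)
    (hρ : ∀ W : Set (Fin n), W.Nonempty → W ≠ Set.univ → (∀ v, ρ v ∈ W ↔ v ∈ W) →
      2 ≤ outCount π W) :
    midpoint ℝ (twoFactor π) (twoFactor ρ) ∈ tspRelaxation n := by
  refine ⟨fun v => ?_, fun W hW hW' => ?_, fun e => ?_⟩
  · rw [edgeWeight_midpoint, edgeWeight_twoFactor π hπ₁, edgeWeight_twoFactor ρ hρ₁,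
      outCount_singleton π hπ₁, outCount_singleton ρ hρ₁]
    norm_num
  · rw [edgeWeight_midpoint, edgeWeight_twoFactor π hπ₁, edgeWeight_twoFactor ρ hρ₁]
    have : 2 ≤ outCount π W + outCount ρ W := by
      rcases Nat.eq_zero_or_pos (outCount π W) with h | h
      · have := hπ W hW hW' (invariant_of_outCount_eq_zero h)
        omega
      rcases Nat.eq_zero_or_pos (outCount ρ W) with h' | h'
      · have := hρ W hW hW' (invariant_of_outCount_eq_zero h')
        omega
      omega
    have : (2 : ℝ) ≤ outCount π W + outCount ρ W := by exact_mod_cast this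
    linarith
  · have h : midpoint ℝ (twoFactor π) (twoFactor ρ) e = (twoFactor π e + twoFactor ρ e) / 2 := by
      rw [midpoint_eq_smul_add]
      simp
      ring
    have := twoFactor_nonneg π e
    have := twoFactor_nonneg ρ e
    have := twoFactor_le_one π hπ₂ e
    have := twoFactor_le_one ρ hρ₂ e
    rw [h]
    constructor <;> linarith

/-- A permutation of `Fin n` whose sign is not that of an `n`-cycle has a nontrivial invariant
set. -/
theorem exists_invariant_of_sign (π : Perm (Fin n)) (hn : 0 < n) (h₁ : ∀ v, π v ≠ v)
    (hs : Perm.sign π = (-1) ^ n) :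
    ∃ W : Set (Fin n), W.Nonempty ∧ W ≠ Set.univ ∧ ∀ v, π v ∈ W ↔ v ∈ W := by
  refine ⟨{v | π.SameCycle ⟨0, hn⟩ v}, ⟨_, Perm.SameCycle.refl _ _⟩, fun h => ?_,
    fun v => Perm.sameCycle_apply_right⟩
  have hc : π.IsCycle := ⟨⟨0, hn⟩, h₁ _, fun y _ => by
    have : y ∈ {v | π.SameCycle ⟨0, hn⟩ v} := h ▸ Set.mem_univ y
    exact this⟩
  have hsupp : π.support = Finset.univ := by ext v; simp [h₁ v]
  have := hc.sign
  rw [hsupp, Finset.card_univ, Fintype.card_fin, hs] at this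
  rcases neg_one_pow_eq_or ℤˣ n with h | h <;> rw [h] at this <;> exact absurd this (by decide)

end TwoFactor

/-! ### Families of 2-factors with independent rotations -/

section Switch

open Equiv

/-- The permutation that applies `ρ` on the invariant set given by `w`. -/
def switchPerm {V : Type*} (ρ : Perm V) (w : V → Bool) (hw : ∀ v, w (ρ v) = w v) : Perm V where
  toFun v := if w v then ρ v else v
  invFun v := if w v then ρ.symm v else v
  left_inv v := by by_cases h : w v <;> simp [h, hw]
  right_inv v := by
    have h' : w (ρ.symm v) = w v := by simpa using (hw (ρ.symm v)).symm
    by_cases h : w v <;> simp [h, h']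

theorem switchPerm_apply {V : Type*} (ρ : Perm V) (w : V → Bool) (hw : ∀ v, w (ρ v) = w v)
    (v : V) : switchPerm ρ w hw v = if w v then ρ v else v := rfl

/-- The cube of the permutation is the identity, and -1 is not a cube root of 1. -/
theorem sign_switchPerm {V : Type*} [Fintype V] [DecidableEq V] (ρ : Perm V)
    (hρ : ∀ v, ρ (ρ (ρ v)) = v) (w : V → Bool) (hw : ∀ v, w (ρ v) = w v) :
    Perm.sign (switchPerm ρ w hw) = 1 := by
  have h : switchPerm ρ w hw ^ 3 = 1 := by
    ext v
    by_cases h : w v <;> simp [pow_succ, switchPerm_apply, h, hw, hρ]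
  have := congrArg Perm.sign h
  rw [map_pow, Perm.sign_one] at this
  rcases Int.units_eq_one_or (Perm.sign (switchPerm ρ w hw)) with h' | h'
  · exact h'
  · rw [h'] at this
    exact absurd this (by decide)

/-- A successor permutation `base` of the cities whose values can be rotated independently on the
nontrivial orbits of `rot`, all of length three. -/
structure SwitchSystem (n : ℕ) where
  base : Perm (Fin n)
  rot : Perm (Fin n)
  rot_cube : ∀ v, rot (rot (rot v)) = v
  -- A rotated city is entered by a forced edge and its possible successors are left by forced
  -- edges, so one unit of degree remains for the switchable edges.
  rot_base : ∀ v, rot v ≠ v → rot (base v) = base v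
  sign_base : Perm.sign base = (-1) ^ n
  no_loop : ∀ v u, u = v ∨ u = rot v → base u ≠ v
  no_digon : ∀ v u a b, u = v ∨ u = rot v → a = base u → b = a ∨ b = rot a → base b ≠ v
  -- A nonempty invariant set meets every nontrivial orbit; applied to the complement too, this
  -- makes nontrivial invariant sets split every such orbit.
  hits : ∀ (w : Fin n → Bool) (W : Set (Fin n)),
    (∀ v, base (if w v then rot v else v) ∈ W ↔ v ∈ W) → (∀ v, w (rot v) = w v) →
      ∀ v, rot v ≠ v → v ∉ W → rot v ∉ W → rot (rot v) ∉ W → W = ∅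

namespace SwitchSystem

variable {n : ℕ} (S : SwitchSystem n)

/-- A choice of the orbits of `rot` on which the successors are rotated. -/
abbrev Choice : Type := {w : Fin n → Bool // ∀ v, w (S.rot v) = w v}

/-- The successor permutation of a choice. -/
def succ (w : S.Choice) : Perm (Fin n) := S.base * switchPerm S.rot w.1 w.2

theorem succ_apply (w : S.Choice) (v : Fin n) :
    S.succ w v = S.base (if w.1 v then S.rot v else v) := rfl

theorem succ_cases (w : S.Choice) (v : Fin n) :
    ∃ u, (u = v ∨ u = S.rot v) ∧ S.succ w v = S.base u := by
  rw [succ_apply]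
  split_ifs
  · exact ⟨_, Or.inr rfl, rfl⟩
  · exact ⟨_, Or.inl rfl, rfl⟩

theorem succ_ne (w : S.Choice) (v : Fin n) : S.succ w v ≠ v := by
  obtain ⟨u, hu, h⟩ := S.succ_cases w v
  rw [h]
  exact S.no_loop v u hu

theorem succ_succ_ne (w : S.Choice) (v : Fin n) : S.succ w (S.succ w v) ≠ v := by
  obtain ⟨u, hu, h⟩ := S.succ_cases w v
  obtain ⟨b, hb, h'⟩ := S.succ_cases w (S.succ w v)
  rw [h']
  exact S.no_digon v u _ b hu h hb

theorem sign_succ (w : S.Choice) : Perm.sign (S.succ w) = (-1) ^ n := by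
  rw [succ, Perm.sign_mul, sign_switchPerm _ S.rot_cube, mul_one, S.sign_base]

/-- A nontrivial invariant set splits every nontrivial orbit of `rot`, in both directions. -/
theorem exists_split (w : S.Choice) {W : Set (Fin n)} (hW : W.Nonempty) (hW' : W ≠ Set.univ)
    (hinv : ∀ v, S.succ w v ∈ W ↔ v ∈ W) {v : Fin n} (hv : S.rot v ≠ v) :
    (∃ u, (u = v ∨ u = S.rot v ∨ u = S.rot (S.rot v)) ∧ u ∈ W ∧ S.rot u ∉ W) ∧
      ∃ u, (u = v ∨ u = S.rot v ∨ u = S.rot (S.rot v)) ∧ u ∉ W ∧ S.rot u ∈ W := by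
  have h₁ := S.hits w.1 W hinv w.2 v hv
  have h₂ := S.hits w.1 Wᶜ (fun v => not_congr (hinv v)) w.2 v hv
  simp only [Set.mem_compl_iff, not_not, Set.compl_empty_iff] at h₂
  have h₃ := S.rot_cube v
  have hne : W ≠ ∅ := hW.ne_empty
  by_cases a : v ∈ W <;> by_cases b : S.rot v ∈ W <;> by_cases c : S.rot (S.rot v) ∈ W <;>
    simp_all

/-- If two choices differ at an orbit of `rot`, then the nontrivial invariant sets of one of them
are left by the other one from a point of this orbit. -/
theorem exists_out (w w' : S.Choice) {W : Set (Fin n)} (hW : W.Nonempty) (hW' : W ≠ Set.univ)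
    (hinv : ∀ v, S.succ w v ∈ W ↔ v ∈ W) {v : Fin n} (hv : S.rot v ≠ v)
    (hne : w.1 v ≠ w'.1 v) :
    ∃ u, (u = v ∨ u = S.rot v ∨ u = S.rot (S.rot v)) ∧ u ∈ W ∧ S.succ w' u ∉ W := by
  obtain ⟨⟨a, ha, haW, haW'⟩, b, hb, hbW, hbW'⟩ := S.exists_split w hW hW' hinv hv
  have hwa : w.1 a = w.1 v := by rcases ha with rfl | rfl | rfl <;> simp [w.2]
  have hwa' : w'.1 a = w'.1 v := by rcases ha with rfl | rfl | rfl <;> simp [w'.2]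
  have hwb : w.1 b = w.1 v := by rcases hb with rfl | rfl | rfl <;> simp [w.2]
  have hwb' : w'.1 b = w'.1 v := by rcases hb with rfl | rfl | rfl <;> simp [w'.2]
  cases h : w.1 v <;> cases h' : w'.1 v
  · exact absurd (h.trans h'.symm) hne
  -- `w'` sends `a` to where `w` sends `rot a`, which is outside `W`.
  · refine ⟨a, ha, haW, ?_⟩
    have := hinv (S.rot a)
    rw [succ_apply, w.2, hwa, h] at this
    rw [succ_apply, hwa', h']
    simpa [haW'] using this
  -- `w'` sends `rot b` to where `w` sends `b`, which is outside `W`.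
  · refine ⟨S.rot b, ?_, hbW', ?_⟩
    · rcases hb with rfl | rfl | rfl <;> simp [S.rot_cube]
    · have := hinv b
      rw [succ_apply, hwb, h] at this
      rw [succ_apply, w'.2, hwb', h']
      simpa [hbW] using this
  · exact absurd (h.trans h'.symm) hne

theorem two_le_outCount_succ (w w' : S.Choice) {W : Set (Fin n)} (hW : W.Nonempty)
    (hW' : W ≠ Set.univ) (hinv : ∀ v, S.succ w v ∈ W ↔ v ∈ W) {u v : Fin n}
    (hu : S.rot u ≠ u) (hv : S.rot v ≠ v) (huw : w.1 u ≠ w'.1 u) (hvw : w.1 v ≠ w'.1 v)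
    (h₀ : v ≠ u) (h₁ : v ≠ S.rot u) (h₂ : v ≠ S.rot (S.rot u)) :
    2 ≤ outCount (S.succ w') W := by
  obtain ⟨a, ha, haW, haW'⟩ := S.exists_out w w' hW hW' hinv hu huw
  obtain ⟨b, hb, hbW, hbW'⟩ := S.exists_out w w' hW hW' hinv hv hvw
  refine two_le_outCount (u := a) (v := b) ?_ haW haW' hbW hbW'
  -- A common exit point would put `u` and `v` on the same orbit.
  rintro rfl
  have c := S.rot_cube u
  have d := S.rot_cube v
  rcases ha with rfl | rfl | rfl <;> rcases hb with h | h | h <;> simp_all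

theorem midpoint_mem (w w' : S.Choice) {u v : Fin n}
    (hu : S.rot u ≠ u) (hv : S.rot v ≠ v) (huw : w.1 u ≠ w'.1 u) (hvw : w.1 v ≠ w'.1 v)
    (h₀ : v ≠ u) (h₁ : v ≠ S.rot u) (h₂ : v ≠ S.rot (S.rot u)) :
    midpoint ℝ (twoFactor (S.succ w)) (twoFactor (S.succ w')) ∈ tspRelaxation n :=
  midpoint_twoFactor_mem _ _ (S.succ_ne w) (S.succ_ne w') (S.succ_succ_ne w) (S.succ_succ_ne w')
    (fun _ hW hW' hinv => S.two_le_outCount_succ w w' hW hW' hinv hu hv huw hvw h₀ h₁ h₂)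
    fun _ hW hW' hinv =>
      S.two_le_outCount_succ w' w hW hW' hinv hu hv huw.symm hvw.symm h₀ h₁ h₂

/-- The edges that are used for every choice. -/
def Forced (e : TSPEdge n) : Prop := ∃ v, S.rot v = v ∧ (e : Sym2 (Fin n)) = s(v, S.base v)

/-- The edges that are used for some choice. -/
def Allowed (e : TSPEdge n) : Prop :=
  ∃ v u, (u = v ∨ u = S.rot v) ∧ (e : Sym2 (Fin n)) = s(v, S.base u)

open Classical in
/-- The objective that rewards the forced edges and punishes the edges that are not allowed. -/
noncomputable def objective (e : TSPEdge n) : ℝ :=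
  if S.Forced e then 1 else if S.Allowed e then 0 else -1

open Classical in
/-- The number of forced edges. -/
noncomputable def value : ℝ := ∑ e : TSPEdge n, if S.Forced e then 1 else 0

theorem value_le_twoFactor (w : S.Choice) :
    S.value ≤ S.objective ⬝ᵥ twoFactor (S.succ w) := by
  classical
  refine Finset.sum_le_sum fun e _ => ?_
  by_cases hf : S.Forced e
  · obtain ⟨v, hv, he⟩ := id hf
    have := one_le_twoFactor (S.succ w) e v (by rw [succ_apply, hv, ite_self, he])
    simpa [objective, hf] using this
  by_cases ha : S.Allowed e
  · simp [objective, hf, ha]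
  · have := twoFactor_eq_zero (S.succ w) e fun v he => by
      obtain ⟨u, hu, h⟩ := S.succ_cases w v
      exact ha ⟨v, u, hu, h ▸ he⟩
    simp [hf, this]

/-- A point of the relaxation with at least the value of the 2-factors uses all forced and only
allowed edges. -/
theorem tight_of_value_le {x : TSPEdge n → ℝ} (hx : x ∈ tspRelaxation n)
    (hval : S.value ≤ S.objective ⬝ᵥ x) :
    (∀ e, S.Forced e → x e = 1) ∧ ∀ e, x e ≠ 0 → S.Allowed e := by
  classical
  have hle (e : TSPEdge n) : S.objective e * x e ≤ if S.Forced e then 1 else 0 := by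
    have := hx.2.2 e
    by_cases hf : S.Forced e
    · simpa [objective, hf] using this.2
    · by_cases ha : S.Allowed e <;> simp [objective, hf, ha, this.1]
  have heq := (Finset.sum_eq_sum_iff_of_le fun e _ => hle e).1
    (le_antisymm (Finset.sum_le_sum fun e _ => hle e) hval)
  refine ⟨fun e he => ?_, fun e he => ?_⟩
  · simpa [objective, he] using heq e (Finset.mem_univ e)
  · by_contra ha
    have hf : ¬ S.Forced e := fun ⟨v, _, h⟩ => ha ⟨v, v, Or.inl rfl, h⟩
    exact he (by simpa [objective, ha, hf] using heq e (Finset.mem_univ e))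

end SwitchSystem

/-- The degree constraint at a city with at most three usable edges. -/
theorem sum_three_edges {n : ℕ} {x : TSPEdge n → ℝ} (hx : x ∈ tspRelaxation n) (a : Fin n)
    {e₁ e₂ e₃ : TSPEdge n} (h₁ : a ∈ (e₁ : Sym2 (Fin n))) (h₂ : a ∈ (e₂ : Sym2 (Fin n)))
    (h₃ : a ∈ (e₃ : Sym2 (Fin n))) (h₁₂ : e₁ ≠ e₂) (h₁₃ : e₁ ≠ e₃) (h₂₃ : e₂ ≠ e₃)
    (hsupp : ∀ e : TSPEdge n, a ∈ (e : Sym2 (Fin n)) → x e ≠ 0 → e = e₁ ∨ e = e₂ ∨ e = e₃) :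
    x e₁ + x e₂ + x e₃ = 2 := by
  classical
  rw [← hx.1 a, edgeWeight, ← Finset.sum_subset (Finset.subset_univ {e₁, e₂, e₃})]
  · rw [Finset.sum_insert (by simp [h₁₂, h₁₃]), Finset.sum_pair h₂₃]
    simp [mem_cutEdges_singleton, h₁, h₂, h₃, add_assoc]
  · intro e _ he
    rw [ite_eq_right_iff, mem_cutEdges_singleton]
    intro hea
    by_contra hxe
    exact he (by simpa using hsupp e hea hxe)

/-! ### Integral points are worse than the family -/

namespace SwitchSystem

variable {n : ℕ} (S : SwitchSystem n)

/-- The edge from a point to its successor when no rotation is applied. -/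
def straight (v : Fin n) : TSPEdge n := tspEdge v (S.base v) (S.no_loop v v (Or.inl rfl)).symm

/-- The edge from a point to its successor when the rotation is applied. -/
def turned (v : Fin n) : TSPEdge n :=
  tspEdge v (S.base (S.rot v)) (S.no_loop v _ (Or.inr rfl)).symm

theorem rot_rot_ne {v : Fin n} (hv : S.rot v ≠ v) : S.rot (S.rot v) ≠ S.rot v :=
  fun h => hv (S.rot.injective h)

theorem eq_straight_or_turned {e : TSPEdge n} (he : S.Allowed e) :
    ∃ v, e = S.straight v ∨ e = S.turned v := by
  obtain ⟨v, u, rfl | rfl, h⟩ := he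
  · exact ⟨u, Or.inl (Subtype.ext h)⟩
  · exact ⟨v, Or.inr (Subtype.ext h)⟩

/-- The degree constraint at a point of a nontrivial orbit. -/
theorem straight_add_turned {x : TSPEdge n → ℝ} (hx : x ∈ tspRelaxation n)
    (hf : ∀ e, S.Forced e → x e = 1) (ha : ∀ e, x e ≠ 0 → S.Allowed e) {v : Fin n}
    (hv : S.rot v ≠ v) : x (S.straight v) + x (S.turned v) = 1 := by
  obtain ⟨p, rfl⟩ := S.base.surjective v
  have hp : S.rot p = p := by
    by_contra h
    exact hv (S.rot_base p h)
  have h₁ : x (S.straight p) = 1 := hf _ ⟨p, hp, rfl⟩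
  have := sum_three_edges hx (S.base p) (e₁ := S.straight p) (e₂ := S.straight (S.base p))
    (e₃ := S.turned (S.base p)) (Sym2.mem_mk_right _ _) (Sym2.mem_mk_left _ _)
    (Sym2.mem_mk_left _ _) ?_ ?_ ?_ ?_
  · linarith
  · intro h
    rcases Sym2.eq_iff.1 (congrArg Subtype.val h) with h | h
    · exact S.no_loop p p (Or.inl rfl) h.1.symm
    · exact S.no_digon p p _ _ (Or.inl rfl) rfl (Or.inl rfl) h.1.symm
  · intro h
    rcases Sym2.eq_iff.1 (congrArg Subtype.val h) with h | h
    · exact S.no_loop p p (Or.inl rfl) h.1.symm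
    · exact S.no_digon p p _ _ (Or.inl rfl) rfl (Or.inr rfl) h.1.symm
  · intro h
    rcases Sym2.eq_iff.1 (congrArg Subtype.val h) with h | h
    · exact hv (S.base.injective h.2).symm
    · exact S.no_loop _ _ (Or.inl rfl) h.2
  · intro e hae hxe
    obtain ⟨u, rfl | rfl⟩ := S.eq_straight_or_turned (ha e hxe)
    · rcases Sym2.mem_iff.1 hae with h | h
      · exact Or.inr (Or.inl (by rw [h]))
      · exact Or.inl (by rw [S.base.injective h])
    · rcases Sym2.mem_iff.1 hae with h | h
      · exact Or.inr (Or.inr (by rw [h]))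
      · obtain rfl := S.base.injective h
        have hu : S.rot u = u := S.rot.injective hp
        refine Or.inl (Subtype.ext ?_)
        change s(u, S.base (S.rot u)) = s(S.rot u, S.base (S.rot u))
        rw [hu]

/-- The degree constraint at the successor of a point of a nontrivial orbit. -/
theorem turned_add_straight {x : TSPEdge n → ℝ} (hx : x ∈ tspRelaxation n)
    (hf : ∀ e, S.Forced e → x e = 1) (ha : ∀ e, x e ≠ 0 → S.Allowed e) {v : Fin n}
    (hv : S.rot v ≠ v) : x (S.turned v) + x (S.straight (S.rot v)) = 1 := by
  set b := S.base (S.rot v) with hb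
  have hrb : S.rot b = b := S.rot_base _ (S.rot_rot_ne hv)
  have h₁ : x (S.straight b) = 1 := hf _ ⟨b, hrb, rfl⟩
  have := sum_three_edges hx b (e₁ := S.straight b) (e₂ := S.turned v)
    (e₃ := S.straight (S.rot v)) (Sym2.mem_mk_left _ _) (Sym2.mem_mk_right _ _)
    (Sym2.mem_mk_right _ _) ?_ ?_ ?_ ?_
  · linarith
  · intro h
    rcases Sym2.eq_iff.1 (congrArg Subtype.val h) with h | h
    · exact S.no_loop v _ (Or.inr rfl) h.1
    · exact S.no_digon v _ _ _ (Or.inr rfl) rfl (Or.inl rfl) h.2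
  · intro h
    rcases Sym2.eq_iff.1 (congrArg Subtype.val h) with h | h
    · exact S.no_loop (S.rot v) _ (Or.inl rfl) h.1
    · exact S.no_digon (S.rot v) _ _ _ (Or.inl rfl) rfl (Or.inl rfl) h.2
  · intro h
    rcases Sym2.eq_iff.1 (congrArg Subtype.val h) with h | h
    · exact hv h.1.symm
    · exact S.no_loop v _ (Or.inr rfl) h.1.symm
  · intro e hae hxe
    obtain ⟨u, rfl | rfl⟩ := S.eq_straight_or_turned (ha e hxe)
    · rcases Sym2.mem_iff.1 hae with h | h
      · exact Or.inl (by rw [h])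
      · exact Or.inr (Or.inr (by rw [S.base.injective h]))
    · rcases Sym2.mem_iff.1 hae with h | h
      · refine Or.inl (Subtype.ext ?_)
        subst h
        change s(b, S.base (S.rot b)) = s(b, S.base b)
        rw [hrb]
      · exact Or.inr (Or.inl (by rw [S.rot.injective (S.base.injective h)]))

/-- The integral points of the relaxation are worse than the 2-factors of the choices. -/
theorem lt_value {x : TSPEdge n → ℝ} (hn : 0 < n) (hx : x ∈ tspRelaxation n)
    (hint : ∀ e, ∃ a : ℤ, x e = a) : S.objective ⬝ᵥ x < S.value := by
  by_contra! hval
  obtain ⟨hf, ha⟩ := S.tight_of_value_le hx hval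
  have h01 (e : TSPEdge n) (he : x e ≠ 0) : x e = 1 := by
    obtain ⟨a, hxa⟩ := hint e
    have h := hx.2.2 e
    rw [hxa] at h he ⊢
    norm_cast at h he ⊢
    omega
  classical
  -- The two degree identities make `x (S.turned v)` constant along the orbits of `rot`, so `x`
  -- determines a choice.
  let w : S.Choice := ⟨fun v => decide (x (S.turned v) = 1), fun v => by
    by_cases hv : S.rot v = v
    · rw [hv]
    · have h₁ := S.turned_add_straight hx hf ha hv
      have h₂ := S.straight_add_turned hx hf ha (S.rot_rot_ne hv)
      simp only [show x (S.turned (S.rot v)) = x (S.turned v) by linarith]⟩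
  have hsupp (e : TSPEdge n) (he : x e ≠ 0) : ∃ v, e = tspEdge v (S.succ w v) (S.succ_ne w v).symm := by
    obtain ⟨v, rfl | rfl⟩ := S.eq_straight_or_turned (ha e he)
    · refine ⟨v, Subtype.ext ?_⟩
      change s(v, S.base v) = s(v, S.base (if w.1 v then S.rot v else v))
      by_cases hv : S.rot v = v
      · rw [hv, ite_self]
      · have h₁ := S.straight_add_turned hx hf ha hv
        rw [h01 _ he] at h₁
        have : w.1 v = false := decide_eq_false (by linarith)
        simp [this]
    · refine ⟨v, Subtype.ext ?_⟩
      change s(v, S.base (S.rot v)) = s(v, S.base (if w.1 v then S.rot v else v))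
      have : w.1 v = true := decide_eq_true (h01 _ he)
      simp [this]
  -- `x` is supported on the 2-factor of `w`, so the cut of an invariant set has weight zero.
  obtain ⟨W, hW, hW', hinv⟩ := exists_invariant_of_sign (S.succ w) hn (S.succ_ne w) (S.sign_succ w)
  have := hx.2.1 W hW hW'
  rw [edgeWeight, Finset.sum_eq_zero] at this
  · norm_num at this
  · intro e _
    rw [ite_eq_right_iff]
    intro he
    by_contra hxe
    obtain ⟨v, rfl⟩ := hsupp e hxe
    rw [tspEdge_mem_cutEdges] at he
    exact he (hinv v).symm

/-- The number of pairwise sufficiently different choices bounds the size of all trees that solve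
the maximization of the objective. -/
theorem card_le_size (hn : 0 < n) {κ : Type*} [Fintype κ] (w : κ → S.Choice)
    (hw : ∀ i j, i ≠ j → ∃ u v, S.rot u ≠ u ∧ S.rot v ≠ v ∧ (w i).1 u ≠ (w j).1 u ∧
      (w i).1 v ≠ (w j).1 v ∧ v ≠ u ∧ v ≠ S.rot u ∧ v ≠ S.rot (S.rot u))
    (T : BBTree (TSPEdge n)) (hT : T.Solves (tspRelaxation n) S.objective) :
    Fintype.card κ ≤ T.size := by
  refine hT.card_le_size (fun i => twoFactor (S.succ (w i))) (fun i => twoFactor_integral _)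
    (fun i j hij => ?_) fun z hz hint i => (S.lt_value hn hz hint).trans_le (S.value_le_twoFactor _)
  obtain ⟨u, v, hu, hv, huw, hvw, h₀, h₁, h₂⟩ := hw i j hij
  exact S.midpoint_mem _ _ hu hv huw hvw h₀ h₁ h₂

end SwitchSystem

end Switch

/-! ### The three strands -/

section Instance

open Equiv

variable {k : ℕ}

/-- The rotation of the first three members of every block of six consecutive cities, as long as
the block lies below `12 * ((k + 1) / 12)`. -/
def tripleRotate (k : ℕ) : Perm (Fin (k + 1)) where
  toFun v := if h : v.1 % 6 < 3 ∧ v.1 < 12 * ((k + 1) / 12) then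
    ⟨v.1 - v.1 % 6 + (v.1 % 6 + 1) % 3, by omega⟩ else v
  invFun v := if h : v.1 % 6 < 3 ∧ v.1 < 12 * ((k + 1) / 12) then
    ⟨v.1 - v.1 % 6 + (v.1 % 6 + 2) % 3, by omega⟩ else v
  left_inv v := by
    apply Fin.ext
    dsimp only
    split_ifs <;> dsimp only at * <;> omega
  right_inv v := by
    apply Fin.ext
    dsimp only
    split_ifs <;> dsimp only at * <;> omega

theorem tripleRotate_val (v : Fin (k + 1)) : (tripleRotate k v).1 =
    if v.1 % 6 < 3 ∧ v.1 < 12 * ((k + 1) / 12) then v.1 - v.1 % 6 + (v.1 % 6 + 1) % 3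
    else v.1 := by
  change (dite _ _ _ : Fin (k + 1)).1 = _
  split_ifs <;> rfl

theorem tripleRotate_ne {v : Fin (k + 1)} :
    tripleRotate k v ≠ v ↔ v.1 % 6 < 3 ∧ v.1 < 12 * ((k + 1) / 12) := by
  rw [Ne, Fin.ext_iff, tripleRotate_val]
  split_ifs <;> omega

/-- Three parallel strands through the cities, two of which are interchanged once. -/
def strands (k : ℕ) (hk : 32 ≤ k) : Perm (Fin (k + 1)) :=
  finRotate (k + 1) ^ 3 * swap ⟨3, by omega⟩ ⟨4, by omega⟩

theorem strands_val (hk : 32 ≤ k) (v : Fin (k + 1)) : (strands k hk v).1 =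
    if v.1 = 3 then 7 else if v.1 = 4 then 6 else
      if v.1 + 3 < k + 1 then v.1 + 3 else v.1 + 3 - (k + 1) := by
  have h (u : Fin (k + 1)) : ((finRotate (k + 1) ^ 3) u).1 = (u.1 + 3) % (k + 1) := by
    have h₁ : (1 : Fin (k + 1)).1 = 1 := Nat.mod_eq_of_lt (show 1 < k + 1 by omega)
    simp only [pow_succ, pow_zero, one_mul, Perm.mul_apply, finRotate_apply, Fin.val_add,
      Nat.mod_add_mod, h₁]
  rw [strands, Perm.mul_apply, h, swap_apply_def]
  have := v.2
  have e₁ : v = ⟨3, by omega⟩ ↔ v.1 = 3 := Fin.ext_iff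
  have e₂ : v = ⟨4, by omega⟩ ↔ v.1 = 4 := Fin.ext_iff
  simp only [e₁, e₂]
  split_ifs
  · exact Nat.mod_eq_of_lt (show 4 + 3 < k + 1 by omega)
  · exact Nat.mod_eq_of_lt (show 3 + 3 < k + 1 by omega)
  · exact Nat.mod_eq_of_lt (by omega)
  · rw [Nat.mod_eq_sub_mod (by omega), Nat.mod_eq_of_lt (by omega)]

/-- The (k+1)-cycle and its cube have sign (-1)^k; the swap, at cities that no rotation moves,
supplies the missing factor -1. -/
theorem sign_strands (hk : 32 ≤ k) : Perm.sign (strands k hk) = (-1) ^ (k + 1) := by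
  rw [strands, Perm.sign_mul, map_pow, sign_finRotate, Nat.add_sub_cancel, Perm.sign_swap (by simp), pow_succ (-1) k]
  rcases neg_one_pow_eq_or ℤˣ k with h | h <;> rw [h] <;> decide

/-- All jumps, with or without a rotation, go at most five cities further. -/
theorem exists_strands_val_eq (hk : 32 ≤ k) {v u : Fin (k + 1)}
    (hu : u = v ∨ u = tripleRotate k v) :
    ∃ d, 1 ≤ d ∧ d ≤ 5 ∧
      ((strands k hk u).1 = v.1 + d ∨ (strands k hk u).1 + (k + 1) = v.1 + d) := by
  have hv := v.2
  have : ((strands k hk u).1 ≤ v.1 + 5 ∧ v.1 + 1 ≤ (strands k hk u).1) ∨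
      (strands k hk u).1 + (k + 1) ≤ v.1 + 5 ∧ v.1 + 1 ≤ (strands k hk u).1 + (k + 1) := by
    rw [strands_val]
    rcases hu with rfl | rfl
    · split_ifs <;> omega
    · rw [tripleRotate_val]
      split_ifs <;> omega
  rcases this with h | h
  · exact ⟨(strands k hk u).1 - v.1, by omega, by omega, Or.inl (by omega)⟩
  · exact ⟨(strands k hk u).1 + (k + 1) - v.1, by omega, by omega, Or.inr (by omega)⟩

section Invariant

variable {w : Fin (k + 1) → Bool} {W : Set (Fin (k + 1))}

theorem exists_pred (hk : 32 ≤ k)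
    (hW : ∀ v, strands k hk (if w v then tripleRotate k v else v) ∈ W ↔ v ∈ W)
    (hw : ∀ v, w (tripleRotate k v) = w v) (v : Fin (k + 1)) :
    ∃ u s, (s = u ∨ s = tripleRotate k u) ∧ strands k hk s = v ∧ (u ∉ W → v ∉ W) := by
  obtain ⟨u, hu⟩ := (strands k hk * switchPerm (tripleRotate k) w hw).surjective v
  rw [Perm.mul_apply, switchPerm_apply] at hu
  refine ⟨u, _, ?_, hu, ?_⟩
  · split_ifs <;> simp
  · rw [← hu, hW]
    exact id

/-- A set that is invariant under the successors and avoids a triple avoids all later cities. -/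
theorem not_mem_of_triple (hk : 32 ≤ k)
    (hW : ∀ v, strands k hk (if w v then tripleRotate k v else v) ∈ W ↔ v ∈ W)
    (hw : ∀ v, w (tripleRotate k v) = w v) (a : ℕ)
    (ha : ∀ v : Fin (k + 1), 6 * a ≤ v.1 → v.1 < 6 * a + 3 → v ∉ W)
    (v : Fin (k + 1)) (hv : 6 * a ≤ v.1) : v ∉ W := by
  induction hi : v.1 using Nat.strong_induction_on generalizing v with
  | _ i ih =>
    subst hi
    rcases lt_or_ge v.1 (6 * a + 3) with h | h
    · exact ha v hv h
    obtain ⟨u, s, hs, hsv, huW⟩ := exists_pred hk hW hw v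
    have hval := congrArg Fin.val hsv
    rw [strands_val] at hval
    have := s.2
    -- From city `6 * a + 3` on, the predecessor is an earlier city, and it does not lie before the
    -- avoided triple.
    have : 6 * a ≤ u.1 ∧ u.1 < v.1 := by
      rcases hs with rfl | rfl
      · split_ifs at hval <;> omega
      · rw [tripleRotate_val] at *
        split_ifs at * <;> omega
    exact huW (ih u.1 this.2 u this.1 rfl)

theorem eq_empty_of_triple (hk : 32 ≤ k)
    (hW : ∀ v, strands k hk (if w v then tripleRotate k v else v) ∈ W ↔ v ∈ W)
    (hw : ∀ v, w (tripleRotate k v) = w v) (v : Fin (k + 1)) (hv : tripleRotate k v ≠ v)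
    (h₀ : v ∉ W) (h₁ : tripleRotate k v ∉ W) (h₂ : tripleRotate k (tripleRotate k v) ∉ W) :
    W = ∅ := by
  have hv' := tripleRotate_ne.1 hv
  have hblock : ∀ u : Fin (k + 1), 6 * (v.1 / 6) ≤ u.1 → u.1 < 6 * (v.1 / 6) + 3 → u ∉ W := by
    intro u hu hu'
    have e₁ := tripleRotate_val v
    have e₂ := tripleRotate_val (tripleRotate k v)
    rw [if_pos hv'] at e₁
    rw [if_pos (by omega)] at e₂
    have : u = v ∨ u = tripleRotate k v ∨ u = tripleRotate k (tripleRotate k v) := by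
      rw [Fin.ext_iff, Fin.ext_iff, Fin.ext_iff]
      omega
    rcases this with rfl | rfl | rfl <;> assumption
  have hlate := not_mem_of_triple hk hW hw _ hblock
  -- Cities 0, 1, 2 are entered only from the end of the circle, which `W` already avoids; the
  -- triple at 0 then excludes all cities.
  refine Set.eq_empty_of_forall_notMem fun u => not_mem_of_triple hk hW hw 0 ?_ u (Nat.zero_le _)
  intro z _ hz
  obtain ⟨u, s, hs, hsz, huW⟩ := exists_pred hk hW hw z
  have hval := congrArg Fin.val hsz
  rw [strands_val] at hval
  refine huW (hlate u ?_)
  have := s.2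
  rcases hs with rfl | rfl
  · split_ifs at hval <;> omega
  · rw [tripleRotate_val] at *
    split_ifs at * <;> omega

end Invariant

/-- Three strands through all cities with rotations of the strands at regular distances. -/
def strandSystem (k : ℕ) (hk : 32 ≤ k) : SwitchSystem (k + 1) where
  base := strands k hk
  rot := tripleRotate k
  rot_cube v := by
    apply Fin.ext
    simp only [tripleRotate_val]
    split_ifs <;> omega
  rot_base v hv := by
    have hv' := tripleRotate_ne.1 hv
    by_contra h
    have h' := tripleRotate_ne.1 h
    rw [strands_val] at h'
    split_ifs at h' <;> omega
  sign_base := sign_strands hk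
  no_loop v u hu h := by
    obtain ⟨d, hd, hd', hval⟩ := exists_strands_val_eq hk hu
    rw [h] at hval
    omega
  no_digon v u a b hu ha hb h := by
    -- Two jumps advance by at least 2 and at most 10 cities, which is less than a full turn.
    obtain ⟨d, hd, hd', hval⟩ := exists_strands_val_eq hk hu
    obtain ⟨d', hd₁, hd₂, hval'⟩ := exists_strands_val_eq hk hb
    rw [← ha] at hval
    rw [h] at hval'
    omega
  hits _ _ hW hw v hv := eq_empty_of_triple hk hW hw v hv

/-- The choice that treats the cities `12 i, …, 12 i + 11` alike. -/
def blockChoice (k : ℕ) (hk : 32 ≤ k) (f : Fin ((k + 1) / 12) → Bool) :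
    (strandSystem k hk).Choice :=
  ⟨fun v => if h : v.1 / 12 < (k + 1) / 12 then f ⟨v.1 / 12, h⟩ else false, fun v => by
    have : (tripleRotate k v).1 / 12 = v.1 / 12 := by
      rw [tripleRotate_val]
      split_ifs <;> omega
    change (if h : (tripleRotate k v).1 / 12 < (k + 1) / 12 then
      f ⟨(tripleRotate k v).1 / 12, h⟩ else false) = _
    simp only [this]⟩

/-- Distinct bit vectors differ at some `i`, hence on both triples of that block, which start at
cities `12 * i` and `12 * i + 6`. -/
theorem two_pow_le_size (hk : 32 ≤ k) (T : BBTree (TSPEdge (k + 1)))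
    (hT : T.Solves (tspRelaxation (k + 1)) (strandSystem k hk).objective) :
    2 ^ ((k + 1) / 12) ≤ T.size := by
  have := (strandSystem k hk).card_le_size k.succ_pos (blockChoice k hk) ?_ T hT
  · simpa using this
  intro f g hfg
  obtain ⟨i, hi⟩ := Function.ne_iff.1 hfg
  have hlt := i.2
  have hval (f : Fin ((k + 1) / 12) → Bool) (v : Fin (k + 1)) (hv : v.1 / 12 = i.1) :
      (blockChoice k hk f).1 v = f i := by
    change dite (v.1 / 12 < _) _ _ = _
    simp only [hv, hlt, dite_true]
  let u : Fin (k + 1) := ⟨12 * i.1, by omega⟩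
  let v : Fin (k + 1) := ⟨12 * i.1 + 6, by omega⟩
  have hu : u.1 = 12 * i.1 := rfl
  have hv : v.1 = 12 * i.1 + 6 := rfl
  have e₁ := tripleRotate_val u
  have e₂ := tripleRotate_val (tripleRotate k u)
  rw [if_pos (by omega)] at e₁
  rw [if_pos (by omega)] at e₂
  refine ⟨u, v, tripleRotate_ne.2 (by omega), tripleRotate_ne.2 (by omega), ?_, ?_, ?_, ?_, ?_⟩
  · rwa [hval f u (by omega), hval g u (by omega)]
  · rwa [hval f v (by omega), hval g v (by omega)]
  · rw [Ne, Fin.ext_iff]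
    omega
  · change ¬ v = tripleRotate k u
    rw [Fin.ext_iff]
    omega
  · change ¬ v = tripleRotate k (tripleRotate k u)
    rw [Fin.ext_iff]
    omega

end Instance

/-! ### The bound for all n -/

theorem mainTheorem2 (n : ℕ) :
    IsGreatest (minSolvingSizes (tspRelaxation n)) (BBhardness (tspRelaxation n)) ∧
    (2 : ℝ) ^ ((n : ℝ) / 16 - 2) ≤ (BBhardness (tspRelaxation n) : ℝ) ∧
    ∃ c : TSPEdge n → ℝ,
      (∃ T : BBTree (TSPEdge n), T.Solves (tspRelaxation n) c) ∧
      ∀ T : BBTree (TSPEdge n), T.Solves (tspRelaxation n) c →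
        (2 : ℝ) ^ ((n : ℝ) / 16 - 2) ≤ (T.size : ℝ) := by
  have hP : ∀ x ∈ tspRelaxation n, ∀ e, 0 ≤ x e ∧ x e ≤ 1 := fun x hx => hx.2.2
  obtain ⟨c, hc⟩ : ∃ c : TSPEdge n → ℝ, ∀ T : BBTree (TSPEdge n),
      T.Solves (tspRelaxation n) c → (2 : ℝ) ^ ((n : ℝ) / 16 - 2) ≤ (T.size : ℝ) := by
    -- Up to n = 32 the exponent is not positive, and any tree has a node.
    rcases Nat.lt_or_ge n 33 with hn | hn
    · refine ⟨0, fun T _ => le_trans ?_ (Nat.one_le_cast.2 T.one_le_size)⟩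
      have : (n : ℝ) ≤ 32 := by exact_mod_cast (by omega : n ≤ 32)
      exact Real.rpow_le_one_of_one_le_of_nonpos one_le_two (by linarith)
    · obtain ⟨k, rfl⟩ : ∃ k, n = k + 1 := ⟨n - 1, by omega⟩
      refine ⟨(strandSystem k (by omega)).objective, fun T hT => ?_⟩
      have h : ((2 : ℝ) ^ ((k + 1) / 12)) ≤ T.size := by
        exact_mod_cast two_pow_le_size (by omega) T hT
      refine le_trans ?_ h
      rw [← Real.rpow_natCast]
      refine Real.rpow_le_rpow_of_exponent_le one_le_two ?_
      -- This is n/16 - 2 ≤ ⌊n/12⌋ with denominators cleared; the slack absorbs the remainder modulo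
      -- 12.
      have : ((k + 1 : ℕ) : ℝ) ≤ 16 * ((k + 1) / 12 : ℕ) + 32 := by
        exact_mod_cast (by omega : k + 1 ≤ 16 * ((k + 1) / 12) + 32)
      linarith
  exact ⟨isGreatest_BBhardness hP, le_BBhardness hP hc, c,
    by classical exact ⟨_, BBTree.solves_full hP c⟩, hc⟩
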